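/- All spaces are real. Let $(X,\|\cdot\|)$ be a Banach space and let $K\subset X^*$ be a precisely norming set for $X$; that is, $\|k\|\le 1$ for all $k\in K$, $\|x\|\le\sup_{k\in K}|k(x)|$ for all $x\in X$, and for each $x\in X$ there is $k_0\in K$ with $|k_0(x)|=\sup_{k\in K}|k(x)|$. (Precisely norming sets of an arbitrary normed space are defined in the same way.) Let $I,J$ be disjoint, possibly empty, sets of integers and let $(K_n)_{n\in I\cup J}$ be weak$^*$ compact sets with $K=\bigcup_{n\in I\cup J}K_n$. Let $(C_i)_{i\in I}\subset(1,2)$ and $(\varepsilon_j)_{j\in J}\subset(0,1)$ be such that $C_i\to1$ along $I$ and $\varepsilon_j\to0$ along $J$, i.e. for each $\eta>0$ only finitely many $i\in I$ satisfy $C_i\ge 1+\eta$ and only finitely many $j\in J$ satisfy $\varepsilon_j\ge\eta$ (no condition if $I$, respectively $J$, is finite; if the sets consist of positive integers, this holds in particular when $C_i\searrow1$ and $\varepsilon_j\searrow0$). For a weak$^*$ compact set $S\subset X^*$ let $x|S\in C(S)$ be the function $k\mapsto k(x)$, and let $X|S=\{x|S:x\in X\}$, a subspace of $C(S)$ with the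 supremum norm $\|\cdot\|_\infty$. A supremum or maximum over the empty set is $-\infty$. Assume: * for every $i\in I$ there is an equivalent norm $\|\cdot\|_i$ on $X|K_i$ such that $\|y\|_\infty\le\|y\|_i\le C_i\|y\|_\infty$ for all $y\in X|K_i$ and $(X|K_i,\|\cdot\|_i)$ has a countable precisely norming set; * for every $j\in J$ there is a finite set $A_j\subset K_j$ such that for every $x\in X$, if $\|x\|=\|x|K_j\|_\infty$, then $\|x\|\le\frac{1}{1-\varepsilon_j}\max_{a\in A_j}|a(x)|$. Then $X$ is isomorphically polyhedral: there is an equivalent norm on $X$ for which the unit ball of every finite-dimensional subspace of $X$ has only finitely many extreme points (finite-dimensional $X$ are not excluded). Moreover, there is an equivalent norm $|\!|\!|\cdot|\!|\!|$ on $X$ with this property for which, in addition, the set of all extreme points $x^*$ of the dual unit ball of $(X,|\!|\!|\cdot|\!|\!|)$ such that $|x^*(x)|=1$ for some $x$ with $|\!|\!|x|\!|\!|\le1$ is countable. -/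

import Mathlib

open Set Filter Topology

noncomputable section

/-- `p` is `C`-equivalent to the given norm of `X`. -/
def IsCEquivalentNorm {X : Type*} [NormedAddCommGroup X] [NormedSpace ℝ X]
    (p : Seminorm ℝ X) (C : ℝ) : Prop :=
  ∀ x : X, C⁻¹ * ‖x‖ ≤ p x ∧ p x ≤ C * ‖x‖

/-- `p` is an equivalent norm on `X`. -/
def IsEquivalentNorm {X : Type*} [NormedAddCommGroup X] [NormedSpace ℝ X]
    (p : Seminorm ℝ X) : Prop :=
  ∃ C : ℝ, 1 ≤ C ∧ IsCEquivalentNorm p C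

/-- The space normed by `p` is polyhedral: the unit ball of each of its finite dimensional
subspaces has only finitely many extreme points. No dimension restriction is built in; finite
dimensional spaces are allowed. -/
def IsPolyhedralNorm {X : Type*} [AddCommGroup X] [Module ℝ X] (p : Seminorm ℝ X) : Prop :=
  ∀ F : Submodule ℝ X, FiniteDimensional ℝ F →
    (Set.extremePoints ℝ {x : X | x ∈ F ∧ p x ≤ 1}).Finite

/-- The closed unit ball of the dual of the space normed by `p` (where `p` is compatible with the
topology of `V`). -/
def dualBall {V : Type*} [AddCommGroup V] [Module ℝ V] [TopologicalSpace V]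
    (p : Seminorm ℝ V) : Set (WeakDual ℝ V) :=
  {f | ∀ v : V, |f v| ≤ p v}

/-- The norm achieving extreme points of the dual unit ball of the space normed by `p`. -/
def nextBall {V : Type*} [AddCommGroup V] [Module ℝ V] [TopologicalSpace V]
    (p : Seminorm ℝ V) : Set (WeakDual ℝ V) :=
  {f | f ∈ Set.extremePoints ℝ (dualBall p) ∧ ∃ v : V, p v ≤ 1 ∧ |f v| = 1}

/-- `E` is isomorphically precisely norming with constant `C` for the space normed by `p`.
The supremum is a genuine one: the third clause (at any vector) makes `E` nonempty and the first
one makes the values bounded. -/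
def IsIsoPreciselyNormingWith {V : Type*} [AddCommGroup V] [Module ℝ V] [TopologicalSpace V]
    (p : Seminorm ℝ V) (C : ℝ) (E : Set (WeakDual ℝ V)) : Prop :=
  (∀ e ∈ E, ∀ v : V, |e v| ≤ C * p v) ∧
  (∀ v : V, C⁻¹ * p v ≤ ⨆ e : E, |(e : WeakDual ℝ V) v|) ∧
  (∀ v : V, ∃ e₀ ∈ E, |e₀ v| = ⨆ e : E, |(e : WeakDual ℝ V) v|)

/-- `E` is precisely norming for the space normed by `p`. -/
def IsPreciselyNorming {V : Type*} [AddCommGroup V] [Module ℝ V] [TopologicalSpace V]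
    (p : Seminorm ℝ V) (E : Set (WeakDual ℝ V)) : Prop :=
  IsIsoPreciselyNormingWith p 1 E

/-- The restriction `x ↦ x | S` of the elements of `X`, seen as functions on the dual, to a
weak* compact set `S`, with values in `C(S)` with the supremum norm. -/
def restrictTo {X : Type*} [NormedAddCommGroup X] [NormedSpace ℝ X]
    (S : TopologicalSpace.Compacts (WeakDual ℝ X)) : X →ₗ[ℝ] C(S, ℝ) where
  toFun x := ⟨fun k => (k : WeakDual ℝ X) x,
    (WeakDual.eval_continuous x).comp continuous_subtype_val⟩
  map_add' x y := by
    ext k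
    exact map_add (k : WeakDual ℝ X) x y
  map_smul' c x := by
    ext k
    exact map_smul (k : WeakDual ℝ X) c x

/-- The normed space `X | S`, a subspace of `C(S)`. -/
abbrev RestrictionSpace {X : Type*} [NormedAddCommGroup X] [NormedSpace ℝ X]
    (S : TopologicalSpace.Compacts (WeakDual ℝ X)) : Submodule ℝ C(S, ℝ) :=
  LinearMap.range (restrictTo S)

/-- `X | S` carries a `C`-equivalent norm, larger than the supremum norm, for which it has a
countable precisely norming set. -/
def HasCountablyNormedRestriction {X : Type*} [NormedAddCommGroup X] [NormedSpace ℝ X]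
    (S : TopologicalSpace.Compacts (WeakDual ℝ X)) (C : ℝ) : Prop :=
  ∃ p : Seminorm ℝ (RestrictionSpace S),
    (∀ y : RestrictionSpace S, ‖y‖ ≤ p y ∧ p y ≤ C * ‖y‖) ∧
    ∃ E : Set (WeakDual ℝ (RestrictionSpace S)), E.Countable ∧ IsPreciselyNorming p E

/-- Some finite subset `A` of `S` almost norms, up to `1 / (1 - ε)`, each `x` with
`‖x‖ = ‖x | S‖`. A supremum or maximum over the empty set counts as `-∞`; therefore the condition
on `x` is void if `S` is empty, and the bound by `max_{a ∈ A} |a x|` asks for some `a ∈ A`. -/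
def HasFiniteAlmostNormingSet {X : Type*} [NormedAddCommGroup X] [NormedSpace ℝ X]
    (S : TopologicalSpace.Compacts (WeakDual ℝ X)) (ε : ℝ) : Prop :=
  ∃ A : Set (WeakDual ℝ X), A.Finite ∧ A ⊆ (S : Set (WeakDual ℝ X)) ∧
    ∀ x : X, (S : Set (WeakDual ℝ X)).Nonempty → ‖x‖ = ‖restrictTo S x‖ →
      ∃ a ∈ A, ‖x‖ ≤ 1 / (1 - ε) * |a x|

/-- `X` is isomorphically polyhedral. -/
def IsIsomorphicallyPolyhedral (X : Type*) [NormedAddCommGroup X] [NormedSpace ℝ X] : Prop :=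
  ∃ p : Seminorm ℝ X, IsEquivalentNorm p ∧ IsPolyhedralNorm p

end

/-! The new norm `p` is the supremum of `|g t ·|` over the countable family of all `(1 + δ) e`, with
`e` in the sets `E i` pulled back from `X | K_i`, and all `b j • a`, with `a ∈ A j`. The factors `δ
→ 0` and `b j → 1` are large enough that `‖x‖ < p x` for `x ≠ 0`. All but finitely many `|g t x|`
stay below some `c < p x`: on the `J` side they accumulate at most at `‖x‖`. On the `I` side `q i x
≤ C i * ‖x‖` with `C i → 1`, and each `q i x` is attained, hence strictly below `p x`, so the `q i
x` have a common bound below `p x`. Such local finiteness makes `p` polyhedral (compactness of the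
sphere of a finite-dimensional subspace) and forces norm-attaining extreme functionals to be some
`±g t` (`IsLocallyFinitelyNorming`). -/

/-! ### Finite maxima and convex combinations -/

theorem exists_lt_forall_le_of_finite {ι : Type*} {s : Set ι} {u : ι → ℝ} {c M : ℝ} (hc : c < M)
    (hfin : {t | c < u t}.Finite) (hu : ∀ t ∈ s, u t < M) :
    ∃ c', c ≤ c' ∧ c' < M ∧ ∀ t ∈ s, u t ≤ c' := by
  have hf : (insert c (u '' ({t | c < u t} ∩ s))).Finite :=
    ((hfin.subset inter_subset_left).image u).insert c
  obtain ⟨m, hm, hmax⟩ := Set.exists_max_image _ id hf ⟨c, mem_insert _ _⟩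
  refine ⟨m, hmax c (mem_insert _ _), ?_, fun t ht => ?_⟩
  · rcases hm with rfl | ⟨t, ⟨-, ht⟩, rfl⟩
    exacts [hc, hu t ht]
  · by_cases h : c < u t
    · exact hmax (u t) (mem_insert_of_mem _ ⟨t, ⟨h, ht⟩, rfl⟩)
    · exact (not_lt.1 h).trans (hmax c (mem_insert _ _))

/-- A linear functional dominated by the maximum of finitely many linear functionals is a convex
combination of them. -/
theorem exists_convex_combination_of_le_max {X ι : Type*} [AddCommGroup X] [Module ℝ X]
    [Fintype ι] (f : X →ₗ[ℝ] ℝ) (h : ι → X →ₗ[ℝ] ℝ) (hf : ∀ d, ∃ t, f d ≤ h t d) :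
    ∃ w : ι → ℝ, (∀ t, 0 ≤ w t) ∧ ∑ t, w t = 1 ∧ ∀ x, f x = ∑ t, w t * h t x := by
  classical
  have : Nonempty ι := ⟨(hf 0).choose⟩
  have hker : ⨅ t, LinearMap.ker (h t) ≤ LinearMap.ker f := by
    intro x hx
    simp only [Submodule.mem_iInf, LinearMap.mem_ker] at hx ⊢
    obtain ⟨t, ht⟩ := hf x
    obtain ⟨s, hs⟩ := hf (-x)
    simp only [map_neg, hx] at ht hs
    linarith
  obtain ⟨c, hc⟩ := (Submodule.mem_span_range_iff_exists_fun ℝ).1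
    (mem_span_of_iInf_ker_le_ker hker)
  let L : (ι → ℝ) →ₗ[ℝ] ℝ := ∑ t, c t • LinearMap.proj t
  let Φ : X →ₗ[ℝ] (ι → ℝ) := LinearMap.pi h
  have hL : ∀ x, L (Φ x) = f x := fun x => by simp [L, Φ, ← hc]
  let N : (ι → ℝ) → ℝ := fun z => ⨆ t, z t
  have hN : ∀ (z : ι → ℝ) t, z t ≤ N z := fun z t => le_ciSup (finite_range z).bddAbove t
  -- Hahn–Banach under the coordinate maximum `N`: testing at `-e_t` makes the coefficients
  -- nonnegative, testing at `±1` makes their sum 1.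
  obtain ⟨g, hg, hgN⟩ := exists_extension_of_le_sublinear
    ⟨LinearMap.range Φ, L.domRestrict _⟩ N
    (fun a ha z => by simp [N, Real.mul_iSup_of_nonneg ha.le])
    (fun y z => ciSup_le fun t => add_le_add (hN y t) (hN z t))
    (by
      rintro ⟨_, x, rfl⟩
      obtain ⟨t, ht⟩ := hf x
      change L (Φ x) ≤ _
      rw [hL]
      exact ht.trans (hN (Φ x) t))
  have hsum : ∀ z, g z = ∑ t, g (Pi.single t 1) * z t := fun z => by
    conv_lhs => rw [← Finset.univ_sum_single z]
    rw [map_sum]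
    refine Finset.sum_congr rfl fun t _ => ?_
    have : (Pi.single t (z t) : ι → ℝ) = z t • Pi.single t 1 := by
      rw [← Pi.single_smul]; simp
    rw [this, map_smul, smul_eq_mul, mul_comm]
  refine ⟨fun t => g (Pi.single t 1), fun t => ?_, ?_, fun x => ?_⟩
  · have h1 := hgN (-Pi.single t 1)
    have h2 : N (-Pi.single t 1) ≤ 0 := ciSup_le fun s => by
      by_cases hs : s = t
      · subst hs; simp
      · simp [hs]
    rw [map_neg] at h1
    linarith
  · have h1 := hgN 1
    have h2 := hgN (-1)
    have h3 := hsum 1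
    simp only [N, Pi.one_apply, Pi.neg_apply, ciSup_const, map_neg, mul_one] at h1 h2 h3
    linarith
  · have := hg ⟨Φ x, x, rfl⟩
    change g (Φ x) = L (Φ x) at this
    rw [← hL, ← this, hsum]
    rfl

/-! ### Locally finite norming families -/

/-- The family `g` norms `p`, and at each nonzero point all but finitely many of its members stay
uniformly below `p`. -/
structure IsLocallyFinitelyNorming {X ι : Type*} [AddCommGroup X] [Module ℝ X]
    [TopologicalSpace X] (p : Seminorm ℝ X) (g : ι → WeakDual ℝ X) : Prop where
  apply_le : ∀ t x, |g t x| ≤ p x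
  exists_eq : ∀ x, x ≠ 0 → ∃ t, |g t x| = p x
  finite : ∀ x, x ≠ 0 → ∃ c < p x, {t | c < |g t x|}.Finite

theorem convex_dualBall {X : Type*} [AddCommGroup X] [Module ℝ X] [TopologicalSpace X]
    (p : Seminorm ℝ X) : Convex ℝ (dualBall p) := by
  intro f hf g hg a b ha hb hab v
  calc |a * f v + b * g v| ≤ |a * f v| + |b * g v| := abs_add_le _ _
    _ = a * |f v| + b * |g v| := by rw [abs_mul, abs_mul, abs_of_nonneg ha, abs_of_nonneg hb]
    _ ≤ a * p v + b * p v := by gcongr; exacts [hf v, hg v]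
    _ = p v := by rw [← add_mul, hab, one_mul]

/-- Near `v` only the finitely many members active at `v` can attain `p`. They therefore dominate
`f` in every direction, and `f` is a convex combination of them up to sign; extremality leaves a
single one. -/
theorem IsLocallyFinitelyNorming.nextBall_subset {X ι : Type*} [AddCommGroup X] [Module ℝ X]
    [TopologicalSpace X] {p : Seminorm ℝ X} {g : ι → WeakDual ℝ X}
    (h : IsLocallyFinitelyNorming p g) :
    nextBall p ⊆ range g ∪ range fun t => -g t := by
  rintro f ⟨hfext, v, hv1, hfv⟩
  have hfp : ∀ x, |f x| ≤ p x := hfext.1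
  have hv : p v = 1 := le_antisymm hv1 (hfv ▸ hfp v)
  have hne : ∀ {x}, 0 < p x → x ≠ 0 := by
    rintro x hx rfl
    simp at hx
  obtain ⟨c, hc, hfin⟩ := h.finite v (hne (by rw [hv]; norm_num))
  rw [hv] at hc
  have hT : {t | |g t v| = 1}.Finite := hfin.subset fun t ht => by
    simp only [mem_ofPred_eq] at ht ⊢
    rwa [ht]
  obtain ⟨c₁, hc₁, hcM, hle⟩ := exists_lt_forall_le_of_finite (s := {t | |g t v| = 1}ᶜ)
    (u := fun t => |g t v|) (c := max c 0) (M := 1) (max_lt hc one_pos)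
    (hfin.subset fun t ht => (le_max_left c 0).trans_lt ht)
    (fun t ht => lt_of_le_of_ne (hv ▸ h.apply_le t v) ht)
  have hc₀ : 0 ≤ c₁ := (le_max_right c 0).trans hc₁
  have hσ : f v * f v = 1 := by rw [← abs_mul_abs_self, hfv, one_mul]
  have := hT.fintype
  -- The sign makes `k t v = f v`.
  let k : {t | |g t v| = 1} → WeakDual ℝ X := fun t => (f v * g t v) • g t
  have hkapp : ∀ t x, k t x = f v * g t v * g t x := fun t x => rfl
  have hk : ∀ t x, |k t x| ≤ p x := fun t x => by
    rw [hkapp, abs_mul, abs_mul, hfv, t.2, one_mul, one_mul]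
    exact h.apply_le t x
  have hdom : ∀ d, ∃ t, f d ≤ k t d := by
    intro d
    have hpd : 0 ≤ p d := apply_nonneg p d
    -- At `v + s • f v • d` inactive members stay below `(1 + c₁) / 2`, while `p` exceeds it.
    obtain ⟨s, hs, hsd⟩ : ∃ s : ℝ, 0 < s ∧ s * p d < (1 - c₁) / 2 := by
      refine ⟨(1 - c₁) / 2 / (p d + 1), by have := sub_pos.2 hcM; positivity, ?_⟩
      rw [div_mul_eq_mul_div, div_lt_iff₀ (by linarith)]
      have := sub_pos.2 hcM
      nlinarith
    have hsm : p (s • f v • d) = s * p d := by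
      rw [map_smul_eq_mul, map_smul_eq_mul, Real.norm_eq_abs, Real.norm_eq_abs, hfv, abs_of_pos hs,
        one_mul]
    have hlow : 1 + s * f d ≤ p (v + s • f v • d) := by
      refine le_trans ?_ (hfp _)
      have : f (v + s • f v • d) = f v * (1 + s * f d) := by
        simp only [map_add, map_smul, smul_eq_mul]; ring
      rw [this, abs_mul, hfv, one_mul]
      exact le_abs_self _
    have hfd : -p d ≤ f d := (abs_le.1 (hfp d)).1
    have hsf : -(s * p d) ≤ s * f d := by nlinarith
    obtain ⟨t, ht⟩ := h.exists_eq (v + s • f v • d) (hne (by linarith))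
    by_cases htT : |g t v| = 1
    · refine ⟨⟨t, htT⟩, ?_⟩
      have hgg : g t v * g t v = 1 := by rw [← abs_mul_abs_self, htT, one_mul]
      have h1 : g t (v + s • f v • d) = g t v * (1 + s * k ⟨t, htT⟩ d) := by
        simp only [hkapp, map_add, map_smul, smul_eq_mul]
        linear_combination (- s * f v * g t d) * hgg
      have h2 := (abs_le.1 (hk ⟨t, htT⟩ d)).1
      have h3 : -(s * p d) ≤ s * k ⟨t, htT⟩ d := by nlinarith
      rw [h1, abs_mul, htT, one_mul, abs_of_nonneg (by linarith)] at ht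
      have h4 : s * f d ≤ s * k ⟨t, htT⟩ d := by linarith
      exact le_of_mul_le_mul_left h4 hs
    · exfalso
      have h1 : |g t (v + s • f v • d)| ≤ |g t v| + |g t (s • f v • d)| := by
        rw [map_add]; exact abs_add_le _ _
      have h2 := h.apply_le t (s • f v • d)
      have h3 : |g t v| ≤ c₁ := hle t htT
      rw [hsm] at h2
      linarith
  obtain ⟨w, hw0, hw1, hw⟩ := exists_convex_combination_of_le_max
    (f : X →ₗ[ℝ] ℝ) (fun t => (k t : X →ₗ[ℝ] ℝ)) hdom
  have hfsum : f = ∑ t, w t • k t := by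
    refine DFunLike.ext _ _ fun x => ?_
    have h1 : (∑ t, w t • k t) x = ∑ t, (w t • k t) x := by
      exact map_sum ((topDualPairing ℝ X).flip x) _ _
    rw [h1]
    exact hw x
  have hmem : f ∈ convexHull ℝ (range k) := by
    rw [hfsum]
    exact (convex_convexHull ℝ _).sum_mem (fun t _ => hw0 t) hw1
      fun t _ => subset_convexHull ℝ _ ⟨t, rfl⟩
  have hsub : convexHull ℝ (range k) ⊆ dualBall p :=
    convexHull_min (by rintro _ ⟨t, rfl⟩; exact hk t) (convex_dualBall p)
  obtain ⟨t, ht⟩ := extremePoints_convexHull_subset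
    (inter_extremePoints_subset_extremePoints_of_subset hsub ⟨hmem, hfext⟩)
  have hone : |f v * g t v| = 1 := by rw [abs_mul, hfv, t.2, one_mul]
  have ht' : (f v * g t v) • g t = f := ht
  rcases eq_or_eq_neg_of_abs_eq hone with h1 | h1
  · left
    exact ⟨t, by rw [← ht', h1, one_smul]⟩
  · right
    exact ⟨t, by change -g t = f; rw [← ht', h1, neg_one_smul]⟩

/-- Along `y + r • (y - z)` the functionals active at `y` are constant and the others have slack, so
a short segment centred at `y` stays in the ball. -/
theorem eq_of_mem_extremePoints_of_forall_apply_eq {X ι : Type*} [AddCommGroup X] [Module ℝ X]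
    [TopologicalSpace X] {p : Seminorm ℝ X} {g : ι → WeakDual ℝ X}
    {F : Submodule ℝ X} {T : Set ι} (hT : T.Finite)
    (hnorm : ∀ x ∈ F, x ≠ 0 → ∃ t ∈ T, |g t x| = p x) (hle : ∀ t x, |g t x| ≤ p x)
    {y z : X} (hy : y ∈ Set.extremePoints ℝ {x : X | x ∈ F ∧ p x ≤ 1}) (hz : z ∈ F)
    (hyz : ∀ t ∈ T, |g t y| = 1 → g t z = g t y) : y = z := by
  classical
  by_contra hne
  obtain ⟨⟨hyF, hy1⟩, hext⟩ := hy
  obtain ⟨c, hc0, hc, hcle⟩ := exists_lt_forall_le_of_finite (c := 0) (M := 1)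
    (s := {t | t ∈ T ∧ |g t y| ≠ 1}) (u := fun t => if t ∈ T then |g t y| else 0) one_pos
    (hT.subset fun t ht => by
      by_contra hn
      simp [hn] at ht)
    (fun t ht => by simpa [ht.1] using lt_of_le_of_ne ((hle t y).trans hy1) ht.2)
  have hpd : 0 ≤ p (y - z) := apply_nonneg p _
  obtain ⟨s, hs, hsd⟩ : ∃ s : ℝ, 0 < s ∧ s * p (y - z) ≤ 1 - c := by
    have := sub_pos.2 hc
    refine ⟨(1 - c) / (p (y - z) + 1), by positivity, ?_⟩
    rw [div_mul_eq_mul_div, div_le_iff₀ (by linarith)]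
    nlinarith
  have key : ∀ r : ℝ, |r| = s → y + r • (y - z) ∈ {x : X | x ∈ F ∧ p x ≤ 1} := by
    intro r hr
    have hmem : y + r • (y - z) ∈ F := F.add_mem hyF (F.smul_mem _ (F.sub_mem hyF hz))
    refine ⟨hmem, ?_⟩
    by_cases h0 : y + r • (y - z) = 0
    · rw [h0, map_zero]; exact zero_le_one
    obtain ⟨t, htT, ht⟩ := hnorm _ hmem h0
    rw [← ht]
    by_cases h1 : |g t y| = 1
    · rw [map_add, map_smul, map_sub, hyz t htT h1, sub_self, smul_zero, add_zero, h1]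
    · have h2 := hcle t ⟨htT, h1⟩
      simp only [htT, if_true] at h2
      have h3 := hle t (r • (y - z))
      rw [map_smul_eq_mul p, Real.norm_eq_abs, hr] at h3
      have h4 := abs_add_le (g t y) (g t (r • (y - z)))
      rw [map_add]
      linarith
  have h1 := hext (key s (abs_of_pos hs)) (key (-s) (by rw [abs_neg, abs_of_pos hs]))
    ⟨1 / 2, 1 / 2, by norm_num, by norm_num, by norm_num, by module⟩
  have h2 : s • (y - z) = 0 := by simpa using h1
  rcases smul_eq_zero.1 h2 with h | h
  exacts [hs.ne' h, hne (sub_eq_zero.1 h)]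

/-- By compactness finitely many `g t` norm all of `F`; an extreme point is then determined by which
of them equal `1` and which equal `-1` there. -/
theorem IsLocallyFinitelyNorming.isPolyhedralNorm {X ι : Type*} [NormedAddCommGroup X]
    [NormedSpace ℝ X] {p : Seminorm ℝ X} {g : ι → WeakDual ℝ X}
    (h : IsLocallyFinitelyNorming p g) {B : ℝ} (hle : ∀ x, ‖x‖ ≤ p x) (hB : ∀ x, p x ≤ B * ‖x‖) :
    IsPolyhedralNorm p := by
  intro F hF
  have hcont : Continuous p := Seminorm.continuous_of_le (q := (Real.toNNReal B) • normSeminorm ℝ X)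
    (by
      change Continuous fun x : X => (Real.toNNReal B : ℝ) * ‖x‖
      fun_prop)
    (fun x => (hB x).trans (mul_le_mul_of_nonneg_right (Real.le_coe_toNNReal B) (norm_nonneg x)))
  have := FiniteDimensional.proper ℝ F
  have hcomp : IsCompact {x : F | p x = 1} := by
    refine Metric.isCompact_of_isClosed_isBounded
      (isClosed_eq (hcont.comp continuous_subtype_val) continuous_const) ?_
    refine (Metric.isBounded_closedBall (x := (0 : F)) (r := 1)).subset fun x hx => ?_
    rw [mem_closedBall_zero_iff]
    exact (hle x).trans_eq hx
  obtain ⟨T, hT, hTS⟩ : ∃ T : Set ι, T.Finite ∧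
      ∀ x ∈ {x : F | p x = 1}, ∃ t ∈ T, |g t (x : X)| = p x := by
    refine hcomp.induction_on (p := fun S : Set F => ∃ T : Set ι, T.Finite ∧
      ∀ x ∈ S, ∃ t ∈ T, |g t (x : X)| = p x) ⟨∅, finite_empty, by simp⟩ ?_ ?_ ?_
    · rintro S S' hSS ⟨T, hT, hTS⟩
      exact ⟨T, hT, fun x hx => hTS x (hSS hx)⟩
    · rintro S S' ⟨T, hT, hTS⟩ ⟨T', hT', hTS'⟩
      refine ⟨T ∪ T', hT.union hT', fun x hx => ?_⟩
      rcases hx with hx | hx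
      · obtain ⟨t, ht, hx⟩ := hTS x hx
        exact ⟨t, Or.inl ht, hx⟩
      · obtain ⟨t, ht, hx⟩ := hTS' x hx
        exact ⟨t, Or.inr ht, hx⟩
    · intro x hx
      have hx0 : (x : X) ≠ 0 := by
        intro h0
        have hx' : p x = 1 := hx
        rw [h0, map_zero] at hx'
        exact zero_ne_one hx'
      obtain ⟨c, hc, hfin⟩ := h.finite x hx0
      have hcF : Continuous fun y : F => p y := hcont.comp continuous_subtype_val
      have hcd : Continuous fun y : F => c + p (y - x : X) :=
        continuous_const.add (hcont.comp (continuous_subtype_val.sub continuous_const))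
      -- On this neighbourhood a member with `|g t x| ≤ c` cannot attain `p y`.
      have hnhds : ∀ᶠ y : F in 𝓝 x, c + p (y - x : X) < p y ∧ 0 < p y :=
        (hcd.continuousAt.eventually_lt hcF.continuousAt (by simpa using hc)).and
          (hcF.continuousAt.eventually (lt_mem_nhds ((norm_pos_iff.2 hx0).trans_le (hle x))))
      refine ⟨_, mem_nhdsWithin_of_mem_nhds hnhds, _, hfin, fun y hy => ?_⟩
      obtain ⟨t, ht⟩ := h.exists_eq y (by
        intro h0
        have := hy.2
        rw [h0, map_zero] at this
        exact lt_irrefl _ this)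
      refine ⟨t, ?_, ht⟩
      have h1 := h.apply_le t (y - x : X)
      have h2 := abs_sub_abs_le_abs_sub (g t (y : X)) (g t x)
      rw [← map_sub] at h2
      have h3 := hy.1
      change c < |g t x|
      linarith
  have hnorm : ∀ x ∈ F, x ≠ 0 → ∃ t ∈ T, |g t x| = p x := by
    intro x hxF hx
    have hpx : 0 < p x := (norm_pos_iff.2 hx).trans_le (hle x)
    obtain ⟨t, htT, ht⟩ := hTS ((p x)⁻¹ • ⟨x, hxF⟩) (by
      change p ((p x)⁻¹ • x) = 1
      rw [map_smul_eq_mul, Real.norm_eq_abs, abs_of_pos (inv_pos.2 hpx), inv_mul_cancel₀ hpx.ne'])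
    refine ⟨t, htT, ?_⟩
    change |g t ((p x)⁻¹ • x)| = p ((p x)⁻¹ • x) at ht
    rw [map_smul, map_smul_eq_mul p, smul_eq_mul, abs_mul, Real.norm_eq_abs] at ht
    exact mul_left_cancel₀ (abs_pos.2 (inv_ne_zero hpx.ne')).ne' ht
  let φ : X → Set ι × Set ι := fun x => ({t | t ∈ T ∧ g t x = 1}, {t | t ∈ T ∧ g t x = -1})
  refine Finite.of_finite_image (f := φ) ((hT.finite_subsets.prod hT.finite_subsets).subset ?_) ?_
  · rintro _ ⟨x, -, rfl⟩
    exact ⟨fun t ht => ht.1, fun t ht => ht.1⟩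
  · intro y hy z hz hyz
    obtain ⟨h1, h2⟩ := Prod.mk.inj hyz
    refine eq_of_mem_extremePoints_of_forall_apply_eq hT hnorm h.apply_le hy hz.1.1
      fun t ht hty => ?_
    rcases eq_or_eq_neg_of_abs_eq hty with h3 | h3
    · have : t ∈ {t | t ∈ T ∧ g t z = 1} := h1 ▸ ⟨ht, h3⟩
      rw [h3, this.2]
    · have : t ∈ {t | t ∈ T ∧ g t z = -1} := h2 ▸ ⟨ht, h3⟩
      rw [h3, this.2]

/-! ### Renorming by a countable family -/

/-- The supremum of a bounded family of functionals, as a seminorm. -/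
noncomputable def supSeminorm {X ι : Type*} [NormedAddCommGroup X] [NormedSpace ℝ X]
    (g : ι → WeakDual ℝ X) (B : ℝ) (hB : ∀ t x, |g t x| ≤ B * ‖x‖) : Seminorm ℝ X :=
  Seminorm.of (fun x => ⨆ t, |g t x|)
    (fun x y => Real.iSup_le (fun t => by
        have hb : ∀ x, BddAbove (range fun t => |g t x|) := fun x =>
          ⟨B * ‖x‖, by rintro _ ⟨t, rfl⟩; exact hB t x⟩
        rw [map_add]
        exact (abs_add_le _ _).trans (add_le_add (le_ciSup (hb x) t) (le_ciSup (hb y) t)))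
      (add_nonneg (Real.iSup_nonneg fun _ => abs_nonneg _) (Real.iSup_nonneg fun _ => abs_nonneg _)))
    (fun a x => by simp [abs_mul, Real.mul_iSup_of_nonneg (abs_nonneg a)])

/-- A countable family of functionals that strictly dominates the norm at nonzero points, with all
but finitely many of its members eventually smaller than some strict lower bound of the supremum,
gives a polyhedral renorming. -/
theorem exists_polyhedral_renorming {X ι : Type*} [NormedAddCommGroup X] [NormedSpace ℝ X]
    [Countable ι] (g : ι → WeakDual ℝ X) (B : ℝ) (hB : ∀ t x, |g t x| ≤ B * ‖x‖)
    (hlt : ∀ x, x ≠ 0 → ∃ t, ‖x‖ < |g t x|)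
    (hfin : ∀ (x : X) (M : ℝ), x ≠ 0 → (∀ t, |g t x| ≤ M) → ‖x‖ < M →
      ∃ c < M, {t | c < |g t x|}.Finite) :
    ∃ p : Seminorm ℝ X, IsEquivalentNorm p ∧ IsPolyhedralNorm p ∧ (nextBall p).Countable := by
  let p := supSeminorm g B hB
  have hgp : ∀ t x, |g t x| ≤ p x := fun t x =>
    le_ciSup (f := fun t => |g t x|) ⟨B * ‖x‖, by rintro _ ⟨t, rfl⟩; exact hB t x⟩ t
  have hpB : ∀ x, p x ≤ max B 1 * ‖x‖ := fun x => Real.iSup_le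
    (fun t => (hB t x).trans (by gcongr; exact le_max_left _ _)) (by positivity)
  have hnp : ∀ x, x ≠ 0 → ‖x‖ < p x := fun x hx =>
    let ⟨t, ht⟩ := hlt x hx
    ht.trans_le (hgp t x)
  have hle : ∀ x, ‖x‖ ≤ p x := fun x => by
    by_cases hx : x = 0
    · simp [hx]
    · exact (hnp x hx).le
  have hfin' : ∀ x, x ≠ 0 → ∃ c < p x, {t | c < |g t x|}.Finite := fun x hx =>
    hfin x (p x) hx (fun t => hgp t x) (hnp x hx)
  have h : IsLocallyFinitelyNorming p g := by
    refine ⟨hgp, fun x hx => ?_, hfin'⟩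
    -- If no member attained `p x`, the finitely many above `c` would also stay below a common `c' <
    -- p x`, contradicting the supremum.
    by_contra! hne
    obtain ⟨c, hc, hf⟩ := hfin' x hx
    obtain ⟨c', -, hc', hall⟩ := exists_lt_forall_le_of_finite (s := univ) hc hf
      fun t _ => lt_of_le_of_ne (hgp t x) (hne t)
    have : Nonempty ι := ⟨(hlt x hx).choose⟩
    exact (ciSup_le fun t => hall t trivial : p x ≤ c').not_gt hc'
  refine ⟨p, ⟨max B 1, le_max_right _ _, fun x => ⟨?_, hpB x⟩⟩, h.isPolyhedralNorm hle hpB,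
    ((countable_range g).union (countable_range _)).mono h.nextBall_subset⟩
  exact (mul_le_of_le_one_left (norm_nonneg x) (inv_le_one_of_one_le₀ (le_max_right _ _))).trans
    (hle x)

/-! ### Pulling back functionals from the restriction spaces -/

theorem IsPreciselyNorming.exists_eq {V : Type*} [AddCommGroup V] [Module ℝ V]
    [TopologicalSpace V] {p : Seminorm ℝ V} {E : Set (WeakDual ℝ V)}
    (hE : IsPreciselyNorming p E) (v : V) : ∃ e ∈ E, |e v| = p v := by
  obtain ⟨e, he, hev⟩ := hE.2.2 v
  refine ⟨e, he, le_antisymm (by simpa using hE.1 e he v) ?_⟩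
  rw [hev]
  simpa using hE.2.1 v

theorem exists_pos_tendsto_cofinite_zero (ι : Type*) [Countable ι] :
    ∃ δ : ι → ℝ, (∀ t, 0 < δ t) ∧ (∀ t, δ t ≤ 1) ∧ Tendsto δ cofinite (𝓝 0) := by
  obtain ⟨f, hf⟩ := exists_injective_nat ι
  refine ⟨fun t => 1 / ((f t : ℝ) + 1), fun t => by positivity, fun t => ?_, ?_⟩
  · rw [div_le_one (by positivity)]
    exact le_add_of_nonneg_left (Nat.cast_nonneg _)
  · exact tendsto_one_div_add_atTop_nhds_zero_nat.comp
      (Nat.cofinite_eq_atTop ▸ hf.tendsto_cofinite)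

theorem finite_lt_of_tendsto_cofinite {ι : Type*} {u v : ι → ℝ} {a c : ℝ}
    (hv : Tendsto v cofinite (𝓝 a)) (hac : a < c) (huv : ∀ t, u t ≤ v t) :
    {t | c < u t}.Finite := by
  have h := hv.eventually_le_const hac
  rw [eventually_cofinite] at h
  exact h.subset fun t ht hle => (ht.trans_le (huv t)).not_ge hle

theorem norm_restrictTo_le {X : Type*} [NormedAddCommGroup X] [NormedSpace ℝ X]
    {S : TopologicalSpace.Compacts (WeakDual ℝ X)} (hS : ∀ k ∈ S, ∀ x, |k x| ≤ ‖x‖) (x : X) :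
    ‖restrictTo S x‖ ≤ ‖x‖ :=
  (ContinuousMap.norm_le _ (norm_nonneg x)).2 fun k => hS k k.2 x

/-- The countable precisely norming set of `X | S`, pulled back to `X`. -/
theorem HasCountablyNormedRestriction.exists_countable {X : Type*} [NormedAddCommGroup X]
    [NormedSpace ℝ X] {S : TopologicalSpace.Compacts (WeakDual ℝ X)} {C : ℝ} (hC : 0 ≤ C)
    (h : HasCountablyNormedRestriction S C) (hS : ∀ k ∈ S, ∀ x, |k x| ≤ ‖x‖) :
    ∃ (q : X → ℝ) (E : Set (WeakDual ℝ X)), E.Countable ∧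
      (∀ x, ‖restrictTo S x‖ ≤ q x) ∧ (∀ x, q x ≤ C * ‖x‖) ∧
      (∀ e ∈ E, ∀ x, |e x| ≤ q x) ∧ ∀ x, ∃ e ∈ E, |e x| = q x := by
  obtain ⟨p, hp, E, hEc, hE⟩ := h
  let R : X →ₗ[ℝ] RestrictionSpace S := (restrictTo S).rangeRestrict
  have hR : ∀ x, ‖R x‖ = ‖restrictTo S x‖ := fun x => rfl
  have hq : ∀ x, p (R x) ≤ C * ‖x‖ := fun x => (hp _).2.trans
    (mul_le_mul_of_nonneg_left (hR x ▸ norm_restrictTo_le hS x) hC)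
  have hle : ∀ e ∈ E, ∀ x, |e (R x)| ≤ p (R x) := fun e he x => by
    simpa using hE.1 e he (R x)
  have hex : ∀ e : E, ∃ f : WeakDual ℝ X, ∀ x, f x = (e : WeakDual ℝ (RestrictionSpace S)) (R x) :=
    fun ⟨e, he⟩ => ⟨StrongDual.toWeakDual
      (((e : RestrictionSpace S →ₗ[ℝ] ℝ) ∘ₗ R).mkContinuous C
        fun x => (hle e he x).trans (hq x)), fun _ => rfl⟩
  choose f hf using hex
  have := hEc.to_subtype
  refine ⟨fun x => p (R x), range f, countable_range f, fun x => hR x ▸ (hp (R x)).1, hq, ?_,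
    fun x => ?_⟩
  · rintro _ ⟨e, rfl⟩ x
    rw [hf]
    exact hle e e.2 x
  · obtain ⟨e, he, hex⟩ := hE.exists_eq (R x)
    exact ⟨f ⟨e, he⟩, ⟨_, rfl⟩, by rw [hf]; exact hex⟩

/-! ### The main theorem -/

theorem mainTheorem3 {X : Type*} [NormedAddCommGroup X] [NormedSpace ℝ X] [CompleteSpace X]
    (K : Set (WeakDual ℝ X)) (hK : IsPreciselyNorming (normSeminorm ℝ X) K)
    (I J : Set ℤ) (hIJ : Disjoint I J)
    (Kn : ℤ → TopologicalSpace.Compacts (WeakDual ℝ X))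
    (hKn : K = ⋃ n ∈ I ∪ J, (Kn n : Set (WeakDual ℝ X)))
    (C : ℤ → ℝ) (hC : ∀ i ∈ I, C i ∈ Set.Ioo (1 : ℝ) 2)
    (hClim : Tendsto (fun i : I => C i) cofinite (𝓝 1))
    (ε : ℤ → ℝ) (hε : ∀ j ∈ J, ε j ∈ Set.Ioo (0 : ℝ) 1)
    (hεlim : Tendsto (fun j : J => ε j) cofinite (𝓝 0))
    (hI : ∀ i ∈ I, HasCountablyNormedRestriction (Kn i) (C i))
    (hJ : ∀ j ∈ J, HasFiniteAlmostNormingSet (Kn j) (ε j)) :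
    IsIsomorphicallyPolyhedral X ∧
      ∃ p : Seminorm ℝ X, IsEquivalentNorm p ∧ IsPolyhedralNorm p ∧ (nextBall p).Countable := by
  suffices hmain : ∃ p : Seminorm ℝ X,
      IsEquivalentNorm p ∧ IsPolyhedralNorm p ∧ (nextBall p).Countable from
    ⟨let ⟨p, h1, h2, _⟩ := hmain; ⟨p, h1, h2⟩, hmain⟩
  have hKle : ∀ n ∈ I ∪ J, ∀ k ∈ Kn n, ∀ x, |k x| ≤ ‖x‖ := fun n hn k hk x => by
    simpa using hK.1 k (hKn ▸ mem_biUnion hn hk) x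
  have hI' := fun i : I => (hI i i.2).exists_countable (zero_le_one.trans (hC i i.2).1.le)
    (hKle i (Or.inl i.2))
  have hJ' : ∀ j : J, HasFiniteAlmostNormingSet (Kn j) (ε j) := fun j => hJ j j.2
  choose q E hEc hqR hqC hEle hEeq using hI'
  choose A hAfin hAsub hA using hJ'
  have : ∀ i, Countable (E i) := fun i => (hEc i).to_subtype
  have : ∀ j, Finite (A j) := fun j => (hAfin j).to_subtype
  -- `δ` tends to `0` over all pairs `(i, e)` jointly, not just for each `i`.
  obtain ⟨δ, hδ0, hδ1, hδ⟩ := exists_pos_tendsto_cofinite_zero (Σ i : I, E i)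
  obtain ⟨d, hd0, -, hd⟩ := exists_pos_tendsto_cofinite_zero J
  -- The first term compensates the loss in the almost norming property; `d j` makes the inequality
  -- strict.
  let b : J → ℝ := fun j => 1 / (1 - ε j) + d j
  have hb : Tendsto b cofinite (𝓝 1) := by
    have h1 : Tendsto (fun j : J => 1 / (1 - ε j)) cofinite (𝓝 (1 / (1 - 0))) :=
      tendsto_const_nhds.div (tendsto_const_nhds.sub hεlim) (by norm_num)
    have h2 := h1.add hd
    rwa [sub_zero, div_one, add_zero] at h2
  have hb0 : ∀ j, 0 < b j := fun j =>
    add_pos (one_div_pos.2 (sub_pos.2 (hε j j.2).2)) (hd0 j)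
  obtain ⟨β, hβ⟩ := hb.bddAbove_range_of_cofinite
  let g₁ : (Σ i : I, E i) → WeakDual ℝ X := fun t => (1 + δ t) • (t.2 : WeakDual ℝ X)
  let g₂ : (Σ j : J, A j) → WeakDual ℝ X := fun t => b t.1 • (t.2 : WeakDual ℝ X)
  have hg₁ : ∀ t x, |g₁ t x| = (1 + δ t) * |(t.2 : WeakDual ℝ X) x| := fun t x => by
    change |(1 + δ t) * (t.2 : WeakDual ℝ X) x| = _
    rw [abs_mul, abs_of_pos (add_pos one_pos (hδ0 t))]
  have hg₂ : ∀ t x, |g₂ t x| = b t.1 * |(t.2 : WeakDual ℝ X) x| := fun t x => by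
    change |b t.1 * (t.2 : WeakDual ℝ X) x| = _
    rw [abs_mul, abs_of_pos (hb0 t.1)]
  have hAle : ∀ (t : Σ j : J, A j) x, |(t.2 : WeakDual ℝ X) x| ≤ ‖x‖ := fun t x =>
    hKle t.1 (Or.inr t.1.2) _ (hAsub t.1 t.2.2) x
  have hgB : ∀ t x, |Sum.elim g₁ g₂ t x| ≤ max 4 β * ‖x‖ := by
    rintro (t | t) x
    · rw [Sum.elim_inl, hg₁]
      have h1 : |(t.2 : WeakDual ℝ X) x| ≤ 2 * ‖x‖ :=
        (hEle t.1 _ t.2.2 x).trans ((hqC t.1 x).trans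
          (mul_le_mul_of_nonneg_right (hC t.1 t.1.2).2.le (norm_nonneg x)))
      calc _ ≤ (1 + 1) * (2 * ‖x‖) := by gcongr; exact hδ1 t
        _ = 4 * ‖x‖ := by ring
        _ ≤ _ := by gcongr; exact le_max_left _ _
    · rw [Sum.elim_inr, hg₂]
      calc _ ≤ β * ‖x‖ := mul_le_mul (hβ ⟨t.1, rfl⟩) (hAle t x) (abs_nonneg _)
            ((hb0 t.1).le.trans (hβ ⟨t.1, rfl⟩))
        _ ≤ _ := by gcongr; exact le_max_right _ _
  refine exists_polyhedral_renorming (Sum.elim g₁ g₂) (max 4 β) hgB (fun x hx => ?_) fun x M hx hM hxM => ?_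
  · have hx0 : 0 < ‖x‖ := norm_pos_iff.2 hx
    obtain ⟨k, hk, hkx⟩ := hK.exists_eq x
    rw [coe_normSeminorm] at hkx
    rw [hKn] at hk
    obtain ⟨n, hn, hkn⟩ := mem_iUnion₂.1 hk
    have hnx : ‖x‖ = ‖restrictTo (Kn n) x‖ := le_antisymm
      (hkx ▸ (restrictTo (Kn n) x).norm_coe_le_norm ⟨k, hkn⟩)
      (norm_restrictTo_le (hKle n hn) x)
    rcases hn with hn | hn
    · obtain ⟨e, he, hex⟩ := hEeq ⟨n, hn⟩ x
      refine ⟨Sum.inl ⟨⟨n, hn⟩, e, he⟩, ?_⟩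
      rw [Sum.elim_inl, hg₁]
      have h1 : ‖x‖ ≤ |e x| := by rw [hex, hnx]; exact hqR ⟨n, hn⟩ x
      have h2 := hδ0 ⟨⟨n, hn⟩, e, he⟩
      change ‖x‖ < (1 + δ ⟨⟨n, hn⟩, e, he⟩) * |e x|
      nlinarith
    · obtain ⟨a, ha, hax⟩ := hA ⟨n, hn⟩ x ⟨k, hkn⟩ hnx
      refine ⟨Sum.inr ⟨⟨n, hn⟩, a, ha⟩, ?_⟩
      rw [Sum.elim_inr, hg₂]
      have h1 : 0 < |a x| := by
        rw [abs_pos]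
        intro h0
        rw [h0, abs_zero, mul_zero] at hax
        exact hx0.not_ge hax
      have h2 := mul_pos (hd0 ⟨n, hn⟩) h1
      change ‖x‖ < (1 / (1 - ε n) + d ⟨n, hn⟩) * |a x|
      rw [add_mul]
      linarith
  · have hM0 : 0 < M := (norm_nonneg x).trans_lt hxM
    have hqM : ∀ i : I, q i x < M := by
      intro i
      obtain ⟨e, he, hex⟩ := hEeq i x
      -- The factor `1 + δ` gives strictness only if `q i x ≠ 0`; otherwise `0 < M` suffices.
      rcases (hex ▸ abs_nonneg (e x) : 0 ≤ q i x).eq_or_lt with h0 | h0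
      · rwa [← h0]
      have h2 := hM (Sum.inl ⟨i, e, he⟩)
      rw [Sum.elim_inl, hg₁] at h2
      change (1 + δ ⟨i, e, he⟩) * |e x| ≤ M at h2
      rw [hex] at h2
      nlinarith [hδ0 ⟨i, e, he⟩]
    obtain ⟨r, hxr, hrM⟩ := exists_between hxM
    -- Only finitely many `q i x` exceed `r`, so one `c' < M` bounds them all; the gap up to `c`
    -- absorbs all but finitely many `δ t`.
    obtain ⟨c', hrc', hc', hqc'⟩ := exists_lt_forall_le_of_finite (s := univ) hrM
      (finite_lt_of_tendsto_cofinite (u := fun i : I => q i x) (a := 1 * ‖x‖)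
        (hClim.mul_const ‖x‖) (by rwa [one_mul]) (fun i => hqC i x)) (fun i _ => hqM i)
    have hc'0 : 0 ≤ c' := ((norm_nonneg x).trans hxr.le).trans hrc'
    obtain ⟨c, hc'c, hcM⟩ := exists_between hc'
    refine ⟨c, hcM, finite_preimage_inl_and_inr.1 ⟨?_, ?_⟩⟩
    · refine finite_lt_of_tendsto_cofinite (u := fun t => |g₁ t x|)
        (a := (1 + 0) * c') ((hδ.const_add 1).mul_const c') (by simpa using hc'c) fun t => ?_
      rw [hg₁]
      exact mul_le_mul_of_nonneg_left ((hEle t.1 _ t.2.2 x).trans (hqc' t.1 trivial))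
        (add_pos one_pos (hδ0 t)).le
    -- Finiteness of each `A j` enters here: `b` still tends to `1` over the pairs `(j, a)`.
    · have hfst : Tendsto (Sigma.fst : (Σ j : J, A j) → J) cofinite cofinite :=
        Tendsto.cofinite_of_finite_preimage_singleton fun j => by
          refine (finite_range fun a : A j => (⟨j, a⟩ : Σ j : J, A j)).subset ?_
          rintro ⟨j', a⟩ rfl
          exact ⟨a, rfl⟩
      refine finite_lt_of_tendsto_cofinite (u := fun t => |g₂ t x|)
        (a := 1 * ‖x‖) ((hb.comp hfst).mul_const ‖x‖) (by linarith) fun t => ?_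
      rw [hg₂]
      exact mul_le_mul_of_nonneg_left (hAle t x) (hb0 t.1).le
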